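/- Let $(A_j)_{j\in\mathbb N}$ be a sequence of unital $C^*$-algebras, let $\varphi_j : A_j \to A_{j+1}$ be injective unital $*$-homomorphisms, and let $\alpha_j : \mathbb R \to \operatorname{Aut} A_j$ be strongly continuous actions such that $\alpha_{j+1,t}\circ\varphi_j = \varphi_j\circ\alpha_{j,t}$ for all $j\in\mathbb N$ and $t\in\mathbb R$. Let $A_\infty = \varinjlim (A_j,\varphi_j)$ be the $C^*$-algebraic direct limit, with canonical maps $\varphi_{j,\infty} : A_j \to A_\infty$. Then there is a strongly continuous action $\alpha : \mathbb R \to \operatorname{Aut} A_\infty$ satisfying $\varphi_{j,\infty}\circ\alpha_{j,t} = \alpha_t\circ\varphi_{j,\infty}$ for all $j\in\mathbb N$ and $t\in\mathbb R$. Moreover, for every $\beta\in[0,\infty)$ there is an affine homeomorphism (for the weak* topologies) $$\mathrm{KMS}_\beta(A_\infty,\alpha) \longrightarrow \varprojlim\bigl(\mathrm{KMS}_\beta(A_j,\alpha_j),\ \phi\mapsto\phi\circ\varphi_{j-1}\bigr)$$ that sends $\phi$ to $(\phi\circ\varphi_{j,\infty})_{j=0}^\infty$. Here, for a $C^*$-algebra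 $A$ with an action $\alpha$ of $\mathbb R$, an element $a\in A$ is analytic if $t\mapsto\alpha_t(a)$ extends to an analytic function $z\mapsto\alpha_z(a)$ from $\mathbb C$ to $A$; $\mathrm{KMS}_0(A,\alpha)$ is the set of $\alpha$-invariant tracial states of $A$; and, for $\beta\neq 0$, $\mathrm{KMS}_\beta(A,\alpha)$ is the set of states $\phi$ with $\phi(ab)=\phi(b\,\alpha_{i\beta}(a))$ for all analytic $a,b\in A$. -/

import Mathlib

open Filter Topology
open scoped ComplexOrder

universe u v

/-! ### Dynamics and KMS states -/

/-- A strongly continuous action of `ℝ` on a unital C*-algebra by *-automorphisms. -/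
structure CStarDynamics (A : Type u) [CStarAlgebra A] where
  /-- The homomorphism from `(ℝ, +)` to the automorphism group. -/
  toAut : Multiplicative ℝ →* (A ≃⋆ₐ[ℂ] A)
  /-- Every orbit map is norm continuous. -/
  strongly_continuous : ∀ a : A, Continuous fun t : ℝ => toAut (Multiplicative.ofAdd t) a

instance CStarDynamics.instCoeFun (A : Type u) [CStarAlgebra A] :
    CoeFun (CStarDynamics A) fun _ => ℝ → (A ≃⋆ₐ[ℂ] A) :=
  ⟨fun α t => α.toAut (Multiplicative.ofAdd t)⟩

/-- `f` is an entire extension of the orbit `t ↦ α_t(a)`, that is, `f z = α_z(a)`. There is at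
most one such `f`, by the identity theorem. -/
def CStarDynamics.IsEntireExtension {A : Type u} [CStarAlgebra A] (α : CStarDynamics A) (a : A)
    (f : ℂ → A) : Prop :=
  AnalyticOnNhd ℂ f Set.univ ∧ ∀ t : ℝ, f (t : ℂ) = α t a

/-- The analytic elements of a dynamics. -/
def CStarDynamics.IsAnalytic {A : Type u} [CStarAlgebra A] (α : CStarDynamics A) (a : A) : Prop :=
  ∃ f : ℂ → A, α.IsEntireExtension a f

/-- States of a unital C*-algebra. -/
structure IsCStarState {A : Type u} [CStarAlgebra A] (ω : WeakDual ℂ A) : Prop where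
  nonneg : ∀ a : A, 0 ≤ ω (star a * a)
  map_one : ω 1 = 1

/-- The set of KMS states at inverse temperature `β`; as a subset of the weak dual it carries the
weak* topology. For `β = 0` these are the invariant tracial states, otherwise the states with
`ω (a b) = ω (b α_{iβ}(a))` for all analytic `a` and `b`. -/
def KMSStates {A : Type u} [CStarAlgebra A] (α : CStarDynamics A) (β : ℝ) :
    Set (WeakDual ℂ A) :=
  {ω | IsCStarState ω ∧
    (β = 0 → (∀ (t : ℝ) (a : A), ω (α t a) = ω a) ∧ ∀ a b : A, ω (a * b) = ω (b * a)) ∧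
    (β ≠ 0 → ∀ a b : A, α.IsAnalytic b → ∀ f : ℂ → A, α.IsEntireExtension a f →
      ω (a * b) = ω (b * f (Complex.I * (β : ℂ))))}

theorem KMSStates.convex {A : Type u} [CStarAlgebra A] (α : CStarDynamics A) (β : ℝ) :
    Convex ℝ (KMSStates α β) := by
  intro μ hμ ν hν s t hs ht hst
  have key : ∀ a : A, (s • μ + t • ν : WeakDual ℂ A) a = (s : ℂ) * μ a + (t : ℂ) * ν a := by
    intro a
    change s • μ a + t • ν a = _
    rw [Complex.real_smul, Complex.real_smul]
  refine ⟨⟨fun a => ?_, ?_⟩, fun h => ⟨fun r a => ?_, fun a b => ?_⟩, fun h a b hb f hf => ?_⟩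
  · rw [key]
    have hs' : (0 : ℂ) ≤ (s : ℂ) := by exact_mod_cast hs
    have ht' : (0 : ℂ) ≤ (t : ℂ) := by exact_mod_cast ht
    exact add_nonneg (mul_nonneg hs' (hμ.1.nonneg a)) (mul_nonneg ht' (hν.1.nonneg a))
  · rw [key, hμ.1.map_one, hν.1.map_one, mul_one, mul_one]
    exact_mod_cast hst
  · rw [key, key, (hμ.2.1 h).1 r a, (hν.2.1 h).1 r a]
  · rw [key, key, (hμ.2.1 h).2 a b, (hν.2.1 h).2 a b]
  · rw [key, key, hμ.2.2 h a b hb f hf, hν.2.2 h a b hb f hf]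

/-- The convex combination `s μ + t ν` of two KMS states. -/
noncomputable def KMSStates.convexComb {A : Type u} [CStarAlgebra A] {α : CStarDynamics A} {β : ℝ}
    (μ ν : KMSStates α β) {s t : ℝ} (hs : 0 ≤ s) (ht : 0 ≤ t) (hst : s + t = 1) : KMSStates α β :=
  ⟨s • (μ : WeakDual ℂ A) + t • (ν : WeakDual ℂ A), KMSStates.convex α β μ.2 ν.2 hs ht hst⟩

/-- A unital *-homomorphism of C*-algebras as a continuous linear map. -/
noncomputable def StarAlgHom.toCLM {A : Type u} {B : Type v} [CStarAlgebra A] [CStarAlgebra B]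
    (ψ : A →⋆ₐ[ℂ] B) : A →L[ℂ] B :=
  ⟨ψ.toAlgHom.toLinearMap,
    (NonUnitalStarAlgHom.instContinuousLinearMapClassComplex (F := A →⋆ₐ[ℂ] B)).map_continuous ψ⟩

/-- The functional `ω ∘ ψ`. -/
noncomputable def WeakDual.pullback {A : Type u} {B : Type v} [CStarAlgebra A] [CStarAlgebra B]
    (ψ : A →⋆ₐ[ℂ] B) (ω : WeakDual ℂ B) : WeakDual ℂ A :=
  StrongDual.toWeakDual ((WeakDual.toStrongDual ω).comp ψ.toCLM)

theorem WeakDual.pullback_apply {A : Type u} {B : Type v} [CStarAlgebra A] [CStarAlgebra B]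
    (ψ : A →⋆ₐ[ℂ] B) (ω : WeakDual ℂ B) (a : A) : WeakDual.pullback ψ ω a = ω (ψ a) := rfl

/-- `ψ` intertwines the dynamics `α` and `γ`. -/
def CStarDynamics.Intertwines {A : Type u} {B : Type v} [CStarAlgebra A] [CStarAlgebra B]
    (α : CStarDynamics A) (γ : CStarDynamics B) (ψ : A →⋆ₐ[ℂ] B) : Prop :=
  ∀ (t : ℝ) (a : A), γ t (ψ a) = ψ (α t a)

theorem CStarDynamics.Intertwines.isEntireExtension {A : Type u} {B : Type v} [CStarAlgebra A]
    [CStarAlgebra B] {α : CStarDynamics A} {γ : CStarDynamics B} {ψ : A →⋆ₐ[ℂ] B}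
    (h : α.Intertwines γ ψ) {a : A} {f : ℂ → A} (hf : α.IsEntireExtension a f) :
    γ.IsEntireExtension (ψ a) (fun z => ψ (f z)) := by
  refine ⟨fun z hz => ?_, fun t => ?_⟩
  · exact (ψ.toCLM.analyticAt (f z)).comp (hf.1 z hz)
  · change ψ (f t) = γ t (ψ a)
    rw [h t a, hf.2 t]

theorem KMSStates.pullback_mem {A : Type u} {B : Type v} [CStarAlgebra A] [CStarAlgebra B]
    {α : CStarDynamics A} {γ : CStarDynamics B} {ψ : A →⋆ₐ[ℂ] B} (h : α.Intertwines γ ψ) {β : ℝ}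
    {ω : WeakDual ℂ B} (hω : ω ∈ KMSStates γ β) : WeakDual.pullback ψ ω ∈ KMSStates α β := by
  refine ⟨⟨fun a => ?_, ?_⟩, fun h0 => ⟨fun t a => ?_, fun a b => ?_⟩, fun h0 a b hb f hf => ?_⟩
  · rw [WeakDual.pullback_apply, map_mul, map_star]
    exact hω.1.nonneg (ψ a)
  · rw [WeakDual.pullback_apply, map_one, hω.1.map_one]
  · rw [WeakDual.pullback_apply, WeakDual.pullback_apply, ← h t a, (hω.2.1 h0).1]
  · rw [WeakDual.pullback_apply, WeakDual.pullback_apply, map_mul ψ, map_mul ψ]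
    exact (hω.2.1 h0).2 _ _
  · obtain ⟨g, hg⟩ := hb
    rw [WeakDual.pullback_apply, WeakDual.pullback_apply, map_mul ψ, map_mul ψ]
    exact hω.2.2 h0 _ _ ⟨_, h.isEntireExtension hg⟩ _ (h.isEntireExtension hf)

/-- The restriction map `ω ↦ ω ∘ ψ` on KMS states, for an intertwining `ψ`. -/
noncomputable def KMSStates.restrict {A : Type u} {B : Type v} [CStarAlgebra A] [CStarAlgebra B]
    {α : CStarDynamics A} {γ : CStarDynamics B} {ψ : A →⋆ₐ[ℂ] B} (h : α.Intertwines γ ψ) (β : ℝ)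
    (ω : KMSStates γ β) : KMSStates α β :=
  ⟨WeakDual.pullback ψ ω, KMSStates.pullback_mem h ω.2⟩

/-- The projective limit of the sets `KMS_β(A_j, α_j)` under the maps `ω ↦ ω ∘ φ_j`, as a
subspace of their product. -/
def KMSProjLimit {A : ℕ → Type u} [∀ j, CStarAlgebra (A j)] {φ : ∀ j, A j →⋆ₐ[ℂ] A (j + 1)}
    {α : ∀ j, CStarDynamics (A j)} (hα : ∀ j, (α j).Intertwines (α (j + 1)) (φ j)) (β : ℝ) :
    Set (∀ j, KMSStates (α j) β) :=
  {x | ∀ j, KMSStates.restrict (hα j) β (x (j + 1)) = x j}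

/-! ### The direct limit of a sequence of unital C*-algebras

It is the Hausdorff completion of the *-algebra of those sequences `(x_j)` with `x_j ∈ A_j` and
`x_{j+1} = φ_j(x_j)` for all large `j`, in the C*-seminorm `lim_j ‖x_j‖`. -/

namespace CStarDirectLimit

variable {A : ℕ → Type u} [∀ j, CStarAlgebra (A j)] (φ : ∀ j, A j →⋆ₐ[ℂ] A (j + 1))

/-- The *-algebra of eventually compatible sequences. -/
def compatible : StarSubalgebra ℂ (∀ j, A j) where
  carrier := {x | ∀ᶠ j in atTop, φ j (x j) = x (j + 1)}
  mul_mem' := fun {x y} hx hy => by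
    filter_upwards [hx, hy] with j h1 h2
    simp [h1, h2]
  one_mem' := by simp
  add_mem' := fun {x y} hx hy => by
    filter_upwards [hx, hy] with j h1 h2
    simp [h1, h2]
  zero_mem' := by simp
  algebraMap_mem' := fun r => by simp [AlgHomClass.commutes]
  star_mem' := fun {x} hx => by
    filter_upwards [hx] with j h1
    simp [h1, map_star]

/-- The *-algebra of eventually compatible sequences, without the product topology. -/
def PreLimit : Type u := compatible φ

noncomputable instance : Ring (PreLimit φ) := inferInstanceAs (Ring (compatible φ))
noncomputable instance : Algebra ℂ (PreLimit φ) := inferInstanceAs (Algebra ℂ (compatible φ))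
noncomputable instance : StarRing (PreLimit φ) := inferInstanceAs (StarRing (compatible φ))
instance : StarModule ℂ (PreLimit φ) := inferInstanceAs (StarModule ℂ (compatible φ))

variable {φ}

/-- The seminorm of a sequence is the limit of the norms of its entries. -/
noncomputable def preNorm (x : PreLimit φ) : ℝ := limUnder atTop fun j => ‖x.1 j‖

theorem tendsto_preNorm (x : PreLimit φ) :
    Tendsto (fun j => ‖x.1 j‖) atTop (𝓝 (preNorm x)) := by
  refine tendsto_nhds_limUnder ?_
  obtain ⟨N, hN⟩ := eventually_atTop.1 x.2
  have h : Antitone fun j => ‖x.1 (N + j)‖ := by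
    refine antitone_nat_of_succ_le fun j => ?_
    have h1 : φ (N + j) (x.1 (N + j)) = x.1 (N + (j + 1)) := hN (N + j) (Nat.le_add_right _ _)
    rw [← h1]
    exact NonUnitalStarAlgHom.norm_apply_le (φ (N + j)) _
  refine ⟨_, (tendsto_add_atTop_iff_nat N).1 ((tendsto_atTop_ciInf h
    ⟨0, by rintro _ ⟨j, rfl⟩; exact norm_nonneg _⟩).congr fun j => ?_)⟩
  change (fun k => ‖x.1 k‖) (N + j) = (fun k => ‖x.1 k‖) (j + N)
  rw [add_comm]

/-- The limit of the norms, as a ring seminorm. -/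
noncomputable def preSeminorm (φ : ∀ j, A j →⋆ₐ[ℂ] A (j + 1)) : RingSeminorm (PreLimit φ) where
  toFun := preNorm
  map_zero' := tendsto_nhds_unique (tendsto_preNorm (0 : PreLimit φ))
    (tendsto_const_nhds.congr fun j => (norm_zero (E := A j)).symm)
  add_le' x y := le_of_tendsto_of_tendsto' (tendsto_preNorm (x + y))
    ((tendsto_preNorm x).add (tendsto_preNorm y)) fun j => norm_add_le (x.1 j) (y.1 j)
  neg' x := tendsto_nhds_unique (tendsto_preNorm (-x))
    ((tendsto_preNorm x).congr fun j => (norm_neg (x.1 j)).symm)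
  mul_le' x y := le_of_tendsto_of_tendsto' (tendsto_preNorm (x * y))
    ((tendsto_preNorm x).mul (tendsto_preNorm y)) fun j => norm_mul_le (x.1 j) (y.1 j)

noncomputable instance : SeminormedRing (PreLimit φ) := (preSeminorm φ).toSeminormedRing

theorem tendsto_norm (x : PreLimit φ) : Tendsto (fun j => ‖x.1 j‖) atTop (𝓝 ‖x‖) :=
  tendsto_preNorm x

noncomputable instance : NormedAlgebra ℂ (PreLimit φ) where
  norm_smul_le r x := le_of_tendsto_of_tendsto' (tendsto_norm (r • x))
    ((tendsto_norm x).const_mul ‖r‖) fun j => norm_smul_le r (x.1 j)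

theorem norm_star_pre (x : PreLimit φ) : ‖star x‖ = ‖x‖ :=
  tendsto_nhds_unique (tendsto_norm (star x))
    ((tendsto_norm x).congr fun j => (norm_star (x.1 j)).symm)

theorem norm_star_mul_self_pre (x : PreLimit φ) : ‖star x * x‖ = ‖x‖ * ‖x‖ :=
  tendsto_nhds_unique (tendsto_norm (star x * x))
    (((tendsto_norm x).mul (tendsto_norm x)).congr
      fun j => (CStarRing.norm_star_mul_self (x := x.1 j)).symm)

theorem uniformContinuous_star_pre :
    UniformContinuous (star : PreLimit φ → PreLimit φ) :=
  (AddMonoidHomClass.isometry_of_norm (starAddEquiv : PreLimit φ ≃+ PreLimit φ)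
    norm_star_pre).uniformContinuous

end CStarDirectLimit

open UniformSpace in
/-- The C*-algebraic direct limit of the sequence `(A_j, φ_j)`. -/
def CStarDirectLimit {A : ℕ → Type u} [∀ j, CStarAlgebra (A j)]
    (φ : ∀ j, A j →⋆ₐ[ℂ] A (j + 1)) : Type u :=
  Completion (CStarDirectLimit.PreLimit φ)

namespace CStarDirectLimit

open UniformSpace

variable {A : ℕ → Type u} [∀ j, CStarAlgebra (A j)] {φ : ∀ j, A j →⋆ₐ[ℂ] A (j + 1)}

noncomputable instance : NormedRing (CStarDirectLimit φ) :=
  inferInstanceAs (NormedRing (Completion (PreLimit φ)))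
noncomputable instance : Algebra ℂ (CStarDirectLimit φ) :=
  inferInstanceAs (Algebra ℂ (Completion (PreLimit φ)))
noncomputable instance : CompleteSpace (CStarDirectLimit φ) :=
  inferInstanceAs (CompleteSpace (Completion (PreLimit φ)))

noncomputable instance : NormedAlgebra ℂ (CStarDirectLimit φ) where
  norm_smul_le := norm_smul_le (α := ℂ) (β := Completion (PreLimit φ))

/-- The class of an eventually compatible sequence. -/
noncomputable def mk (φ : ∀ j, A j →⋆ₐ[ℂ] A (j + 1)) : PreLimit φ →ₐ[ℂ] CStarDirectLimit φ where
  __ := (Completion.coeRingHom : PreLimit φ →+* Completion (PreLimit φ))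
  commutes' _ := rfl

theorem norm_mk (x : PreLimit φ) : ‖mk φ x‖ = ‖x‖ := Completion.norm_coe x

theorem continuous_mk : Continuous (mk φ) := Completion.continuous_coe _

theorem denseRange_mk : DenseRange (mk φ) := Completion.denseRange_coe

/-- The involution, extended by continuity. -/
noncomputable instance : Star (CStarDirectLimit φ) :=
  ⟨Completion.map (star : PreLimit φ → PreLimit φ)⟩

theorem star_mk (x : PreLimit φ) : star (mk φ x) = mk φ (star x) :=
  Completion.map_coe uniformContinuous_star_pre x

theorem continuous_star_lim : Continuous (star : CStarDirectLimit φ → CStarDirectLimit φ) :=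
  Completion.continuous_map

noncomputable instance : StarRing (CStarDirectLimit φ) where
  star_involutive x := by
    refine denseRange_mk.induction_on x ?_ fun x => ?_
    · exact isClosed_eq (continuous_star_lim.comp continuous_star_lim) continuous_id
    · rw [star_mk, star_mk, star_star]
  star_mul x y := by
    refine denseRange_mk.induction_on₂ ?_ (fun x y => ?_) x y
    · exact isClosed_eq (continuous_star_lim.comp continuous_mul)
        ((continuous_star_lim.comp continuous_snd).mul (continuous_star_lim.comp continuous_fst))
    · rw [← map_mul, star_mk, star_mk, star_mk, ← map_mul, star_mul]
  star_add x y := by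
    refine denseRange_mk.induction_on₂ ?_ (fun x y => ?_) x y
    · exact isClosed_eq (continuous_star_lim.comp continuous_add)
        ((continuous_star_lim.comp continuous_fst).add (continuous_star_lim.comp continuous_snd))
    · rw [← map_add, star_mk, star_mk, star_mk, ← map_add, star_add]

instance : StarModule ℂ (CStarDirectLimit φ) where
  star_smul r x := by
    refine denseRange_mk.induction_on x ?_ fun x => ?_
    · exact isClosed_eq (continuous_star_lim.comp (continuous_const_smul r))
        (continuous_star_lim.const_smul (star r))
    · rw [← map_smul, star_mk, star_mk, ← map_smul, star_smul]

instance : CStarRing (CStarDirectLimit φ) where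
  norm_mul_self_le x := by
    refine denseRange_mk.induction_on x ?_ fun x => ?_
    · exact isClosed_le (continuous_norm.mul continuous_norm)
        (continuous_norm.comp (continuous_star_lim.mul continuous_id))
    · rw [star_mk, ← map_mul, norm_mk, norm_mk, norm_star_mul_self_pre]

noncomputable instance : CStarAlgebra (CStarDirectLimit φ) where

/-- The connecting homomorphism `A_j → A_k` for `j ≤ k`. -/
noncomputable def connecting (φ : ∀ j, A j →⋆ₐ[ℂ] A (j + 1)) {j k : ℕ} (h : j ≤ k) :
    A j →⋆ₐ[ℂ] A k :=
  Nat.leRec (motive := fun k _ => A j →⋆ₐ[ℂ] A k) (StarAlgHom.id ℂ (A j))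
    (fun k _ f => (φ k).comp f) h

theorem connecting_self (j : ℕ) (a : A j) : connecting φ (le_refl j) a = a := by
  rw [connecting, Nat.leRec_self]
  rfl

theorem connecting_succ {j k : ℕ} (h : j ≤ k) (a : A j) :
    connecting φ (Nat.le_succ_of_le h) a = φ k (connecting φ h a) := by
  rw [connecting, Nat.leRec_succ _ _ h]
  rfl

/-- The sequence `(0, …, 0, a, φ_j(a), φ_{j+1}(φ_j(a)), …)` starting at position `j`. -/
noncomputable def thread (φ : ∀ j, A j →⋆ₐ[ℂ] A (j + 1)) (j : ℕ) (a : A j) : PreLimit φ :=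
  ⟨fun k => if h : j ≤ k then connecting φ h a else 0, by
    filter_upwards [eventually_ge_atTop j] with k hk
    rw [dif_pos hk, dif_pos (Nat.le_succ_of_le hk), connecting_succ hk]⟩

theorem thread_apply {j k : ℕ} (h : j ≤ k) (a : A j) : (thread φ j a).1 k = connecting φ h a :=
  dif_pos h

theorem mk_eq_of_eventuallyEq {x y : PreLimit φ} (h : ∀ᶠ k in atTop, x.1 k = y.1 k) :
    mk φ x = mk φ y := by
  rw [← sub_eq_zero, ← map_sub, ← norm_eq_zero, norm_mk]
  refine tendsto_nhds_unique (tendsto_norm (x - y)) (tendsto_const_nhds.congr' ?_)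
  filter_upwards [h] with k hk
  change 0 = ‖x.1 k - y.1 k‖
  rw [hk, sub_self, norm_zero]

/-- The canonical map `φ_{j,∞} : A_j → A_∞`. -/
noncomputable def of (φ : ∀ j, A j →⋆ₐ[ℂ] A (j + 1)) (j : ℕ) :
    A j →⋆ₐ[ℂ] CStarDirectLimit φ where
  toFun a := mk φ (thread φ j a)
  map_one' := by
    rw [← map_one (mk φ)]
    refine mk_eq_of_eventuallyEq ?_
    filter_upwards [eventually_ge_atTop j] with k hk
    rw [thread_apply hk, map_one]
    rfl
  map_mul' a b := by
    rw [← map_mul]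
    refine mk_eq_of_eventuallyEq ?_
    filter_upwards [eventually_ge_atTop j] with k hk
    change _ = (thread φ j a).1 k * (thread φ j b).1 k
    rw [thread_apply hk, thread_apply hk, thread_apply hk, map_mul]
  map_zero' := by
    rw [← map_zero (mk φ)]
    refine mk_eq_of_eventuallyEq ?_
    filter_upwards [eventually_ge_atTop j] with k hk
    rw [thread_apply hk, map_zero]
    rfl
  map_add' a b := by
    rw [← map_add]
    refine mk_eq_of_eventuallyEq ?_
    filter_upwards [eventually_ge_atTop j] with k hk
    change _ = (thread φ j a).1 k + (thread φ j b).1 k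
    rw [thread_apply hk, thread_apply hk, thread_apply hk, map_add]
  commutes' r := by
    rw [← AlgHomClass.commutes (mk φ) r]
    refine mk_eq_of_eventuallyEq ?_
    filter_upwards [eventually_ge_atTop j] with k hk
    rw [thread_apply hk, AlgHomClass.commutes]
    rfl
  map_star' a := by
    rw [star_mk]
    refine mk_eq_of_eventuallyEq ?_
    filter_upwards [eventually_ge_atTop j] with k hk
    change _ = star ((thread φ j a).1 k)
    rw [thread_apply hk, thread_apply hk, map_star]

theorem mk_eq_of {x : PreLimit φ} {N : ℕ} (hN : ∀ k, N ≤ k → φ k (x.1 k) = x.1 (k + 1)) :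
    mk φ x = of φ N (x.1 N) := by
  refine mk_eq_of_eventuallyEq ?_
  filter_upwards [eventually_ge_atTop N] with k hk
  rw [thread_apply hk]
  induction k, hk using Nat.le_induction with
  | base => rw [connecting_self]
  | succ k hk ih => rw [connecting_succ hk, ← ih, hN k hk]

theorem of_succ (j : ℕ) (a : A j) : of φ (j + 1) (φ j a) = of φ j a := by
  have h := mk_eq_of (φ := φ) (x := thread φ j a) (N := j + 1) fun k hk => by
    rw [thread_apply (by omega : j ≤ k), thread_apply (by omega : j ≤ k + 1),
      connecting_succ (by omega : j ≤ k)]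
  rw [thread_apply (Nat.le_succ j), connecting_succ (le_refl j), connecting_self] at h
  exact h.symm

/-- The universal property of the direct limit. -/
theorem existsUnique_lift {C : Type v} [CStarAlgebra C] (ψ : ∀ j, A j →⋆ₐ[ℂ] C)
    (hψ : ∀ j a, ψ (j + 1) (φ j a) = ψ j a) :
    ∃! Ψ : CStarDirectLimit φ →⋆ₐ[ℂ] C, ∀ j a, Ψ (of φ j a) = ψ j a := by
  have stable : ∀ x : PreLimit φ, ∃ c : C, ∀ᶠ k in atTop, ψ k (x.1 k) = c := by
    intro x
    obtain ⟨N, hN⟩ := eventually_atTop.1 x.2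
    refine ⟨ψ N (x.1 N), eventually_atTop.2 ⟨N, fun k hk => ?_⟩⟩
    induction k, hk using Nat.le_induction with
    | base => rfl
    | succ k hk ih => rw [← hN k hk, hψ, ih]
  choose f hf using stable
  have uniq : ∀ {x : PreLimit φ} {c : C}, (∀ᶠ k in atTop, ψ k (x.1 k) = c) → f x = c := by
    intro x c h
    obtain ⟨k, h1, h2⟩ := ((hf x).and h).exists
    exact h1.symm.trans h2
  let F : PreLimit φ →+* C :=
    { toFun := f
      map_one' := uniq (Eventually.of_forall fun k => map_one (ψ k))
      map_zero' := uniq (Eventually.of_forall fun k => map_zero (ψ k))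
      map_mul' := fun x y => uniq (by
        filter_upwards [hf x, hf y] with k h1 h2
        rw [← h1, ← h2]
        exact map_mul (ψ k) (x.1 k) (y.1 k))
      map_add' := fun x y => uniq (by
        filter_upwards [hf x, hf y] with k h1 h2
        rw [← h1, ← h2]
        exact map_add (ψ k) (x.1 k) (y.1 k)) }
  have bound : ∀ x, ‖F x‖ ≤ 1 * ‖x‖ := by
    intro x
    rw [one_mul]
    refine ge_of_tendsto (tendsto_norm x) ?_
    filter_upwards [hf x] with k hk
    change ‖f x‖ ≤ _
    rw [← hk]
    exact NonUnitalStarAlgHom.norm_apply_le (ψ k) _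
  have hF : Continuous F := AddMonoidHomClass.continuous_of_bound F 1 bound
  let G : CStarDirectLimit φ →+* C := Completion.extensionHom F hF
  have hG : Continuous G := Completion.continuous_extension
  have G_mk : ∀ x, G (mk φ x) = f x := fun x => Completion.extensionHom_coe F hF x
  let Ψ : CStarDirectLimit φ →⋆ₐ[ℂ] C :=
    { G with
      commutes' := fun r => by
        change G (algebraMap ℂ _ r) = _
        rw [← AlgHomClass.commutes (mk φ) r, G_mk]
        exact uniq (Eventually.of_forall fun k => AlgHomClass.commutes (ψ k) r)
      map_star' := fun x => by
        change G (star x) = star (G x)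
        refine denseRange_mk.induction_on x ?_ fun x => ?_
        · exact isClosed_eq (hG.comp continuous_star_lim) (continuous_star.comp hG)
        · rw [star_mk, G_mk, G_mk]
          refine uniq ?_
          filter_upwards [hf x] with k hk
          rw [← hk]
          exact map_star (ψ k) (x.1 k) }
  have Ψ_of : ∀ j a, Ψ (of φ j a) = ψ j a := by
    intro j a
    change G (mk φ (thread φ j a)) = ψ j a
    rw [G_mk]
    refine uniq ?_
    filter_upwards [eventually_ge_atTop j] with k hk
    rw [thread_apply hk]
    induction k, hk using Nat.le_induction with
    | base => rw [connecting_self]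
    | succ k hk ih => rw [connecting_succ hk, hψ, ih]
  refine ⟨Ψ, Ψ_of, fun Φ hΦ => ?_⟩
  refine DFunLike.coe_injective (denseRange_mk.equalizer Φ.toCLM.continuous Ψ.toCLM.continuous ?_)
  funext x
  obtain ⟨N, hN⟩ := eventually_atTop.1 x.2
  change Φ (mk φ x) = Ψ (mk φ x)
  rw [mk_eq_of hN, hΦ, Ψ_of]

end CStarDirectLimit

/-!
The images of the `A j` are dense in the direct limit, so by the universal property the
automorphisms `α j t` induce a one-parameter group on it (`CStarDirectLimit.dynamics`), whose orbits
are uniform limits of continuous ones.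

Restricting a state to all the `A j` loses nothing, by density. Conversely, a compatible sequence of
states consists of contractive functionals (`IsCStarState.norm_apply_le`) and so extends to the
direct limit (`CStarDirectLimit.exists_functional`). Because states are contractive, continuity of
the evaluations on the images of the `A j` controls all evaluations, which makes the inverse weak*
continuous (`CStarDirectLimit.continuous_of_continuous_of`).

What remains is that the extension is a KMS state (`CStarDirectLimit.mem_KMSStates`). Positivity,
invariance and the trace property are closed conditions. For `β ≠ 0`, however, an analytic element
of the limit need not be approximated by elements of the `A j` together with its value at time `iβ`.
Gaussian smearing repairs this: `S_z a = ∫ exp (-(x - m z)²) α_{x/m}(a) dx` is bounded linear in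
`a`, entire in `z`, and natural in the dynamics, so that on each `A j` the KMS condition gives
`ω (S_0 a * S_0 b) = ω (S_0 b * S_{iβ} a)`. This identity is closed in `a` and `b`, hence holds on the
whole limit. If `f` is the entire extension of the orbit of `a`, then `S_z a = S_0 (f z)` by the
identity theorem (`CStarDynamics.IsEntireExtension.smear_eq`), and since `S_0` tends to `√π` times
the identity as `m → ∞`, the identity becomes `ω (a * b) = ω (b * f (iβ))`
(`CStarDynamics.kms_of_denseRange`).
-/

/-! ### States and dynamics -/

/-- A state has norm at most one: Cauchy-Schwarz against the unit, in the form of the positivity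
of the variance `ω ((a - ω a)* (a - ω a))`. -/
theorem IsCStarState.norm_apply_le {A : Type u} [CStarAlgebra A] {ω : WeakDual ℂ A}
    (hω : IsCStarState ω) (a : A) : ‖ω a‖ ≤ ‖a‖ := by
  let := CStarAlgebra.spectralOrder A
  have := CStarAlgebra.spectralOrderedRing A
  have hpos : ∀ x : A, 0 ≤ x → 0 ≤ ω x := fun x hx => by
    obtain ⟨b, rfl⟩ := CStarAlgebra.nonneg_iff_eq_star_mul_self.1 hx
    exact hω.nonneg b
  let f : A →ₚ[ℂ] ℂ := PositiveLinearMap.mk₀ (WeakDual.toStrongDual ω).toLinearMap hpos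
  have hstar : ω (star a) = star (ω a) := map_star f a
  have hvar : 0 ≤ ω (star a * a) - star (ω a) * ω a := by
    convert hω.nonneg (a - algebraMap ℂ A (ω a)) using 1
    simp only [star_sub, sub_mul, mul_sub, map_sub, Algebra.algebraMap_eq_smul_one, star_smul,
      star_one, smul_mul_assoc, mul_smul_comm, one_mul, mul_one, map_smul, hstar, hω.map_one,
      smul_eq_mul]
    ring
  have hle : 0 ≤ ω (algebraMap ℝ A (‖a‖ ^ 2)) - ω (star a * a) := by
    rw [← map_sub]
    exact hpos _ (sub_nonneg.2 CStarAlgebra.star_mul_le_algebraMap_norm_sq)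
  have hscal : ω (algebraMap ℝ A (‖a‖ ^ 2)) = ((‖a‖ ^ 2 : ℝ) : ℂ) := by
    rw [IsScalarTower.algebraMap_apply ℝ ℂ A, Algebra.algebraMap_eq_smul_one, map_smul, hω.map_one]
    simp
  have hfin : ((‖ω a‖ ^ 2 : ℝ) : ℂ) ≤ ((‖a‖ ^ 2 : ℝ) : ℂ) := by
    have h := add_nonneg hvar hle
    rw [hscal, sub_add_sub_cancel', sub_nonneg] at h
    simpa [Complex.conj_mul'] using h
  exact (sq_le_sq₀ (norm_nonneg _) (norm_nonneg _)).1 (by exact_mod_cast hfin)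

namespace CStarDynamics

variable {A : Type u} [CStarAlgebra A] (α : CStarDynamics A)

theorem apply_add (s t : ℝ) (a : A) : α (s + t) a = α s (α t a) := by
  exact DFunLike.congr_fun (map_mul α.toAut (.ofAdd s) (.ofAdd t)) a

theorem apply_zero (a : A) : α 0 a = a := by
  exact DFunLike.congr_fun (map_one α.toAut) a

theorem intertwines_self (t : ℝ) : α.Intertwines α (α t).toStarAlgHom := fun s a => by
  change α s (α t a) = α t (α s a)
  rw [← apply_add, ← apply_add, add_comm]

/-! ### Gaussian smearing -/

theorem norm_gaussian_le {w : ℂ} {R : ℝ} (hw : ‖w‖ ≤ R) (x : ℝ) :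
    ‖Complex.exp (-((x : ℂ) - w) ^ 2)‖ ≤ Real.exp (3 * R ^ 2) * Real.exp (-(1 / 2) * x ^ 2) := by
  rw [Complex.norm_exp, ← Real.exp_add]
  refine Real.exp_le_exp.2 ?_
  have h1 : (-((x : ℂ) - w) ^ 2).re = -(x - w.re) ^ 2 + w.im ^ 2 := by
    simp [pow_two]
    ring
  have h2 : w.re ^ 2 + w.im ^ 2 ≤ R ^ 2 := by
    rw [← Complex.sq_norm_sub_sq_re w]
    nlinarith [norm_nonneg w]
  rw [h1]
  nlinarith [sq_nonneg (x - 2 * w.re), sq_nonneg w.re, sq_nonneg w.im]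

/-- Half of the Gaussian decay absorbs the linear factor. -/
theorem norm_gaussian_deriv_le {w : ℂ} {R : ℝ} (hw : ‖w‖ ≤ R) (x : ℝ) :
    ‖((x : ℂ) - w) * Complex.exp (-((x : ℂ) - w) ^ 2)‖ ≤
      (1 + R) * Real.exp (3 * R ^ 2) * Real.exp (-(1 / 4) * x ^ 2) := by
  have hR : 0 ≤ R := (norm_nonneg w).trans hw
  have h1 : ‖(x : ℂ) - w‖ ≤ (1 + R) * Real.exp (1 / 4 * x ^ 2) := by
    have h2 : ‖(x : ℂ) - w‖ ≤ |x| + R := (norm_sub_le _ _).trans (by simpa using hw)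
    have h3 := Real.add_one_le_exp (1 / 4 * x ^ 2)
    have h4 : |x| ≤ 1 + 1 / 4 * x ^ 2 := by nlinarith [sq_nonneg (|x| - 2), sq_abs x]
    nlinarith [sq_nonneg x]
  calc _ ≤ ((1 + R) * Real.exp (1 / 4 * x ^ 2)) *
        (Real.exp (3 * R ^ 2) * Real.exp (-(1 / 2) * x ^ 2)) := by
        rw [norm_mul]
        exact mul_le_mul h1 (norm_gaussian_le hw x) (norm_nonneg _) (by positivity)
    _ = (1 + R) * Real.exp (3 * R ^ 2) *
        (Real.exp (1 / 4 * x ^ 2) * Real.exp (-(1 / 2) * x ^ 2)) := by ring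
    _ = _ := by
        rw [← Real.exp_add]
        congr 2
        ring

theorem continuous_smear_integrand (m : ℝ) (z : ℂ) (a : A) :
    Continuous fun x : ℝ => Complex.exp (-((x : ℂ) - m * z) ^ 2) • α (x / m) a :=
  (by fun_prop : Continuous fun x : ℝ => Complex.exp (-((x : ℂ) - m * z) ^ 2)).smul
    ((α.strongly_continuous a).comp (by fun_prop : Continuous fun x : ℝ => x / m))

theorem norm_smear_integrand_le (m : ℝ) (z : ℂ) (a : A) (x : ℝ) :
    ‖Complex.exp (-((x : ℂ) - m * z) ^ 2) • α (x / m) a‖ ≤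
      Real.exp (3 * ‖(m : ℂ) * z‖ ^ 2) * Real.exp (-(1 / 2) * x ^ 2) * ‖a‖ := by
  rw [norm_smul, StarAlgEquiv.norm_map]
  exact mul_le_mul_of_nonneg_right (norm_gaussian_le le_rfl x) (norm_nonneg a)

theorem integrable_smear_integrand (m : ℝ) (z : ℂ) (a : A) :
    MeasureTheory.Integrable fun x : ℝ => Complex.exp (-((x : ℂ) - m * z) ^ 2) • α (x / m) a :=
  (((integrable_exp_neg_mul_sq (by norm_num)).const_mul _).mul_const _).mono'
    (α.continuous_smear_integrand m z a).aestronglyMeasurable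
    (Eventually.of_forall (α.norm_smear_integrand_le m z a))

/-- The Gaussian smearing `a ↦ ∫ exp (-(x - m z)²) α_{x/m}(a) dx` of the orbit of `a`, centred at
the complex time `z`. The kernel is not normalised: its total mass is `√π`. The
parameter `m` is the inverse width; for `m = 0` the quotient `x / m` is `0`, so the statements that
translate the orbit assume `m ≠ 0`. -/
noncomputable def smear (m : ℝ) (z : ℂ) : A →L[ℂ] A :=
  LinearMap.mkContinuous
    { toFun := fun a => ∫ x : ℝ, Complex.exp (-((x : ℂ) - m * z) ^ 2) • α (x / m) a
      map_add' := fun a b => by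
        rw [← MeasureTheory.integral_add (α.integrable_smear_integrand m z a)
          (α.integrable_smear_integrand m z b)]
        simp only [map_add, smul_add]
      map_smul' := fun c a => by
        rw [RingHom.id_apply, ← MeasureTheory.integral_smul]
        simp only [map_smul, smul_comm c] }
    (∫ x : ℝ, Real.exp (3 * ‖(m : ℂ) * z‖ ^ 2) * Real.exp (-(1 / 2) * x ^ 2))
    fun a => by
      rw [← MeasureTheory.integral_mul_const]
      exact MeasureTheory.norm_integral_le_of_norm_le
        (((integrable_exp_neg_mul_sq (by norm_num)).const_mul _).mul_const _)
        (Eventually.of_forall (α.norm_smear_integrand_le m z a))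

theorem smear_apply (m : ℝ) (z : ℂ) (a : A) :
    α.smear m z a = ∫ x : ℝ, Complex.exp (-((x : ℂ) - m * z) ^ 2) • α (x / m) a := rfl

theorem Intertwines.map_smear {B : Type v} [CStarAlgebra B] {α : CStarDynamics A}
    {γ : CStarDynamics B} {ψ : A →⋆ₐ[ℂ] B} (h : α.Intertwines γ ψ) (m : ℝ) (z : ℂ) (a : A) :
    γ.smear m z (ψ a) = ψ (α.smear m z a) := by
  change _ = ψ.toCLM _
  rw [smear_apply, smear_apply,
    ← ψ.toCLM.integral_comp_comm (α.integrable_smear_integrand m z a)]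
  congr 1 with x
  rw [map_smul, h]
  rfl

/-- Smearing at a real time `t` is smearing at time `0` of the translate by `t`. -/
theorem smear_ofReal {m : ℝ} (hm : m ≠ 0) (t : ℝ) (a : A) :
    α.smear m t a = α.smear m 0 (α t a) := by
  rw [smear_apply, smear_apply, ← MeasureTheory.integral_add_right_eq_self _ (m * t)]
  congr 1 with x
  rw [← apply_add, add_div, mul_div_cancel_left₀ t hm]
  push_cast
  rw [add_sub_cancel_right, mul_zero, sub_zero]

theorem hasDerivAt_smear (m : ℝ) (z : ℂ) (a : A) :
    HasDerivAt (fun z => α.smear m z a)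
      (∫ x : ℝ, (2 * m * (((x : ℂ) - m * z) * Complex.exp (-((x : ℂ) - m * z) ^ 2))) •
        α (x / m) a) z := by
  have hα : Continuous fun x : ℝ => α (x / m) a :=
    (α.strongly_continuous a).comp (by fun_prop : Continuous fun x : ℝ => x / m)
  -- `R` bounds `‖m * w‖` for all `w` in the unit ball around `z`.
  set R : ℝ := |m| * (‖z‖ + 1)
  refine (hasDerivAt_integral_of_dominated_loc_of_deriv_le (𝕜 := ℂ)
    (F' := fun z (x : ℝ) =>
      (2 * m * (((x : ℂ) - m * z) * Complex.exp (-((x : ℂ) - m * z) ^ 2))) • α (x / m) a)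
    (bound := fun x => 2 * |m| *
      ((1 + R) * Real.exp (3 * R ^ 2) * Real.exp (-(1 / 4) * x ^ 2)) * ‖a‖)
    (Metric.ball_mem_nhds z one_pos)
    (Eventually.of_forall fun w => (α.continuous_smear_integrand m w a).aestronglyMeasurable)
    (α.integrable_smear_integrand m z a) ?_ ?_ ?_ ?_).2
  · exact ((by fun_prop : Continuous fun x : ℝ =>
      2 * m * (((x : ℂ) - m * z) * Complex.exp (-((x : ℂ) - m * z) ^ 2))).smul
        hα).aestronglyMeasurable
  · refine Eventually.of_forall fun x w hw => ?_
    have hR : ‖(m : ℂ) * w‖ ≤ R := by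
      rw [norm_mul, Complex.norm_real, Real.norm_eq_abs]
      refine mul_le_mul_of_nonneg_left ?_ (abs_nonneg m)
      have h1 := norm_le_norm_add_norm_sub' w z
      rw [mem_ball_iff_norm] at hw
      linarith
    rw [norm_smul, StarAlgEquiv.norm_map, norm_mul]
    refine mul_le_mul_of_nonneg_right ?_ (norm_nonneg a)
    refine mul_le_mul ?_ (norm_gaussian_deriv_le hR x) (norm_nonneg _) (by positivity)
    simp
  · exact (((integrable_exp_neg_mul_sq (by norm_num)).const_mul _).const_mul _).mul_const _
  · refine Eventually.of_forall fun x w _ => HasDerivAt.smul_const ?_ _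
    have h1 : HasDerivAt (fun w : ℂ => (x : ℂ) - m * w) (-(m : ℂ)) w := by
      simpa using ((hasDerivAt_id w).const_mul (m : ℂ)).const_sub (x : ℂ)
    refine (h1.pow 2).neg.cexp.congr_deriv ?_
    simp only [Pi.neg_apply, Pi.pow_apply, Nat.cast_ofNat]
    ring

theorem analyticOnNhd_smear (m : ℝ) (a : A) :
    AnalyticOnNhd ℂ (fun z => α.smear m z a) Set.univ := fun z _ =>
  Differentiable.analyticAt (fun w => (α.hasDerivAt_smear m w a).differentiableAt) z

/-- Smeared elements are analytic. -/
theorem isEntireExtension_smear {m : ℝ} (hm : m ≠ 0) (a : A) :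
    α.IsEntireExtension (α.smear m 0 a) fun z => α.smear m z a := by
  refine ⟨α.analyticOnNhd_smear m a, fun t => ?_⟩
  change α.smear m t a = _
  rw [smear_ofReal α hm]
  exact (α.intertwines_self t).map_smear m 0 a

/-- Entire functions that agree on the real line agree everywhere. -/
theorem eq_of_eq_ofReal {f g : ℂ → A} (hf : AnalyticOnNhd ℂ f Set.univ)
    (hg : AnalyticOnNhd ℂ g Set.univ) (h : ∀ t : ℝ, f t = g t) : f = g := by
  refine hf.eq_of_frequently_eq (z₀ := 0) hg ?_
  have h0 : Tendsto (fun t : ℝ => (t : ℂ)) (𝓝[≠] 0) (𝓝[≠] 0) :=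
    tendsto_nhdsWithin_iff.2
      ⟨(Complex.continuous_ofReal.tendsto' 0 0 Complex.ofReal_zero).mono_left nhdsWithin_le_nhds,
        by filter_upwards [self_mem_nhdsWithin] with t ht
           simpa using ht⟩
  exact h0.frequently (Eventually.frequently (Eventually.of_forall h))

/-- The entire extension of an orbit commutes with smearing: both sides are entire in `z` and agree
for real `z`. -/
theorem IsEntireExtension.smear_eq {α : CStarDynamics A} {a : A} {f : ℂ → A}
    (hf : α.IsEntireExtension a f) {m : ℝ} (hm : m ≠ 0) (z : ℂ) :
    α.smear m z a = α.smear m 0 (f z) := by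
  refine congrFun (eq_of_eq_ofReal (α.analyticOnNhd_smear m a)
    (fun z hz => ((α.smear m 0).analyticAt (f z)).comp (hf.1 z hz)) fun t => ?_) z
  rw [smear_ofReal α hm]
  exact congrArg _ (hf.2 t).symm

/-- As the Gaussian narrows, smearing tends to multiplication by the mass `√π` of the kernel. -/
theorem tendsto_smear (a : A) :
    Tendsto (fun n : ℕ => α.smear (n + 1) 0 a) atTop (𝓝 (((√Real.pi : ℝ) : ℂ) • a)) := by
  have hlim : ((√Real.pi : ℝ) : ℂ) • a =
      ∫ x : ℝ, Complex.exp (-((x : ℂ) - 0) ^ 2) • a := by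
    have h := integral_gaussian 1
    rw [div_one] at h
    rw [integral_smul_const, ← h, ← integral_complex_ofReal]
    congr 2 with x
    push_cast
    rw [sub_zero, neg_one_mul]
  rw [hlim]
  refine MeasureTheory.tendsto_integral_filter_of_dominated_convergence
    (fun x => Real.exp (3 * (0 : ℝ) ^ 2) * Real.exp (-(1 / 2) * x ^ 2) * ‖a‖)
    (Eventually.of_forall fun n =>
      (α.continuous_smear_integrand (n + 1) 0 a).aestronglyMeasurable)
    (Eventually.of_forall fun n => Eventually.of_forall fun x => ?_)
    (((integrable_exp_neg_mul_sq (by norm_num)).const_mul _).mul_const _)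
    (Eventually.of_forall fun x => ?_)
  · simpa using α.norm_smear_integrand_le (n + 1) 0 a x
  · simp only [mul_zero]
    refine Tendsto.const_smul ?_ _
    have h1 : Tendsto (fun n : ℕ => x / ((n : ℝ) + 1)) atTop (𝓝 0) :=
      tendsto_const_nhds.div_atTop
        (tendsto_atTop_add_const_right _ _ tendsto_natCast_atTop_atTop)
    have h2 := ((α.strongly_continuous a).tendsto 0).comp h1
    rwa [apply_zero] at h2

/-- The KMS condition propagates from the smearings of a dense family to all analytic elements. -/
theorem kms_of_denseRange {ι : Type*} {e : ι → A} (he : DenseRange e) (ω : A →L[ℂ] ℂ) (w : ℂ)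
    (h : ∀ (m : ℝ), m ≠ 0 → ∀ i j, ω (α.smear m 0 (e i) * α.smear m 0 (e j)) =
      ω (α.smear m 0 (e j) * α.smear m w (e i)))
    {a b : A} {f : ℂ → A} (hf : α.IsEntireExtension a f) : ω (a * b) = ω (b * f w) := by
  have hall : ∀ (m : ℝ), m ≠ 0 → ∀ x y, ω (α.smear m 0 x * α.smear m 0 y) =
      ω (α.smear m 0 y * α.smear m w x) := fun m hm x y => by
    refine he.induction_on₂ ?_ (fun i j => h m hm i j) x y
    exact isClosed_eq (by fun_prop) (by fun_prop)
  have h1 := (ω.continuous.tendsto _).comp ((α.tendsto_smear a).mul (α.tendsto_smear b))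
  have h2 := (ω.continuous.tendsto _).comp ((α.tendsto_smear b).mul (α.tendsto_smear (f w)))
  have h3 := tendsto_nhds_unique h1 (h2.congr fun n => by
    have hn : (n : ℝ) + 1 ≠ 0 := by positivity
    simp only [Function.comp_apply]
    rw [hall _ hn a b, hf.smear_eq hn])
  simp only [smul_mul_smul_comm, map_smul, smul_eq_mul] at h3
  refine mul_left_cancel₀ ?_ h3
  have hpi : (√Real.pi : ℝ) ≠ 0 := by positivity
  exact_mod_cast mul_ne_zero hpi hpi

end CStarDynamics

namespace CStarDirectLimit

variable {A : ℕ → Type u} [∀ j, CStarAlgebra (A j)] {φ : ∀ j, A j →⋆ₐ[ℂ] A (j + 1)}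

/-! ### Density of the canonical images -/

theorem exists_mk_eq_of₂ (x y : PreLimit φ) :
    ∃ (N : ℕ) (a b : A N), mk φ x = of φ N a ∧ mk φ y = of φ N b := by
  obtain ⟨N, hN⟩ := eventually_atTop.1 (x.2.and y.2)
  exact ⟨N, x.1 N, y.1 N, mk_eq_of fun k hk => (hN k hk).1, mk_eq_of fun k hk => (hN k hk).2⟩

/-- A closed property that holds on the images of all the `A j` holds on the direct limit. -/
theorem induction_on_closed {p : CStarDirectLimit φ → Prop} (hp : IsClosed {x | p x})
    (h : ∀ j a, p (of φ j a)) (x : CStarDirectLimit φ) : p x := by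
  refine denseRange_mk.induction_on x hp fun y => ?_
  obtain ⟨N, a, -, h1, -⟩ := exists_mk_eq_of₂ y y
  rw [h1]
  exact h N a

theorem hom_ext {C : Type v} [CStarAlgebra C] {Φ Ψ : CStarDirectLimit φ →⋆ₐ[ℂ] C}
    (h : ∀ j a, Φ (of φ j a) = Ψ (of φ j a)) : Φ = Ψ :=
  (existsUnique_lift (fun j => Ψ.comp (of φ j))
    fun j a => congrArg Ψ (of_succ j a)).unique h fun _ _ => rfl

/-! ### The limit dynamics -/

section Dynamics

variable {α : ∀ j, CStarDynamics (A j)}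

theorem exists_action (hα : ∀ j, (α j).Intertwines (α (j + 1)) (φ j)) (t : ℝ) :
    ∃ Γ : CStarDirectLimit φ →⋆ₐ[ℂ] CStarDirectLimit φ,
      ∀ j a, Γ (of φ j a) = of φ j (α j t a) :=
  (existsUnique_lift (fun j => (of φ j).comp (α j t).toStarAlgHom) fun j a => by
    change of φ (j + 1) (α (j + 1) t (φ j a)) = of φ j (α j t a)
    rw [hα, of_succ]).exists

variable (hα : ∀ j, (α j).Intertwines (α (j + 1)) (φ j))

/-- The endomorphism of the direct limit induced by the automorphisms at time `t`. -/
noncomputable def action (t : ℝ) : CStarDirectLimit φ →⋆ₐ[ℂ] CStarDirectLimit φ :=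
  (exists_action hα t).choose

theorem action_of (t : ℝ) (j : ℕ) (a : A j) : action hα t (of φ j a) = of φ j (α j t a) :=
  (exists_action hα t).choose_spec j a

theorem action_zero : action hα 0 = StarAlgHom.id ℂ (CStarDirectLimit φ) :=
  hom_ext fun j a => by
    rw [action_of, CStarDynamics.apply_zero]
    rfl

theorem action_add (s t : ℝ) : action hα (s + t) = (action hα s).comp (action hα t) :=
  hom_ext fun j a => by
    rw [StarAlgHom.comp_apply, action_of, action_of, action_of, CStarDynamics.apply_add]

/-- The dynamics on the direct limit induced by an intertwined sequence of dynamics. -/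
noncomputable def dynamics : CStarDynamics (CStarDirectLimit φ) where
  toAut :=
    { toFun := fun t => StarAlgEquiv.ofStarAlgHom (action hα t.toAdd) (action hα (-t.toAdd))
        (by rw [← action_add, neg_add_cancel, action_zero])
        (by rw [← action_add, add_neg_cancel, action_zero])
      map_one' := StarAlgEquiv.ext fun x => DFunLike.congr_fun (action_zero hα) x
      map_mul' := fun s t =>
        StarAlgEquiv.ext fun x => DFunLike.congr_fun (action_add hα s.toAdd t.toAdd) x }
  strongly_continuous x := by
    change Continuous fun t : ℝ => action hα t x
    -- The orbit map of `x` is a uniform limit of orbit maps of elements of the images of the `A j`.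
    refine continuous_of_uniform_approx_of_continuous fun u hu => ?_
    obtain ⟨ε, hε, hu⟩ := Metric.mem_uniformity_dist.1 hu
    obtain ⟨y, hy⟩ := denseRange_mk.exists_dist_lt x hε
    obtain ⟨N, a, -, h1, -⟩ := exists_mk_eq_of₂ y y
    refine ⟨fun t => action hα t (of φ N a), ?_, fun t => hu ?_⟩
    · simp only [action_of]
      exact (of φ N).toCLM.continuous.comp ((α N).strongly_continuous a)
    · rw [← h1, dist_eq_norm, ← map_sub]
      refine (NonUnitalStarAlgHom.norm_apply_le (action hα t) _).trans_lt ?_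
      rwa [← dist_eq_norm]

theorem intertwines_of (j : ℕ) : (α j).Intertwines (dynamics hα) (of φ j) :=
  fun t a => action_of hα t j a

end Dynamics

/-! ### Functionals and KMS states on the direct limit -/

/-- A compatible sequence of contractive functionals comes from a contractive functional on the
direct limit. -/
theorem exists_functional {ω : ∀ j, WeakDual ℂ (A j)} (hω : ∀ j a, ‖ω j a‖ ≤ ‖a‖)
    (hφ : ∀ j a, ω (j + 1) (φ j a) = ω j a) :
    ∃ Ω : WeakDual ℂ (CStarDirectLimit φ),
      (∀ j a, Ω (of φ j a) = ω j a) ∧ ∀ x, ‖Ω x‖ ≤ ‖x‖ := by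
  have stable : ∀ x : PreLimit φ, ∃ c : ℂ, ∀ᶠ k in atTop, ω k (x.1 k) = c := by
    intro x
    obtain ⟨N, hN⟩ := eventually_atTop.1 x.2
    refine ⟨ω N (x.1 N), eventually_atTop.2 ⟨N, fun k hk => ?_⟩⟩
    induction k, hk using Nat.le_induction with
    | base => rfl
    | succ k hk ih => rw [← hN k hk, hφ, ih]
  choose f hf using stable
  have uniq : ∀ {x : PreLimit φ} {c : ℂ}, (∀ᶠ k in atTop, ω k (x.1 k) = c) → f x = c := by
    intro x c h
    obtain ⟨k, h1, h2⟩ := ((hf x).and h).exists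
    exact h1.symm.trans h2
  let F : PreLimit φ →ₗ[ℂ] ℂ :=
    { toFun := f
      map_add' := fun x y => uniq (by
        filter_upwards [hf x, hf y] with k h1 h2
        rw [← h1, ← h2]
        exact map_add (ω k) (x.1 k) (y.1 k))
      map_smul' := fun c x => uniq (by
        filter_upwards [hf x] with k h1
        rw [← h1]
        exact map_smul (ω k) c (x.1 k)) }
  have bound : ∀ x, ‖F x‖ ≤ 1 * ‖(mk φ).toLinearMap x‖ := by
    intro x
    rw [one_mul]
    refine (ge_of_tendsto (tendsto_norm x) ?_).trans_eq (norm_mk x).symm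
    filter_upwards [hf x] with k hk
    change ‖f x‖ ≤ _
    rw [← hk]
    exact hω k _
  have dense : DenseRange (mk φ).toLinearMap := denseRange_mk
  refine ⟨StrongDual.toWeakDual (F.extendOfNorm (mk φ).toLinearMap), fun j a => ?_, fun x => ?_⟩
  · refine (LinearMap.extendOfNorm_eq dense ⟨1, bound⟩ (thread φ j a)).trans (uniq ?_)
    filter_upwards [eventually_ge_atTop j] with k hk
    rw [thread_apply hk]
    induction k, hk using Nat.le_induction with
    | base => rw [connecting_self]
    | succ k hk ih => rw [connecting_succ hk, hφ, ih]
  · exact (LinearMap.norm_extendOfNorm_apply_le dense 1 bound x).trans_eq (one_mul _)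

theorem weakDual_ext {Ω Ω' : WeakDual ℂ (CStarDirectLimit φ)}
    (h : ∀ j a, Ω (of φ j a) = Ω' (of φ j a)) : Ω = Ω' :=
  DFunLike.ext _ _ (induction_on_closed
    (isClosed_eq (WeakDual.toStrongDual Ω).continuous (WeakDual.toStrongDual Ω').continuous) h)

variable {α : ∀ j, CStarDynamics (A j)} {hα : ∀ j, (α j).Intertwines (α (j + 1)) (φ j)} {β : ℝ}

/-- A functional on the direct limit is a KMS state as soon as its restrictions to the `A j` are.
For `β ≠ 0` this uses that smearing maps each `A j` into its own analytic elements, so that the KMS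
condition on the limit only has to be checked on smearings of elements of the `A j`. -/
theorem mem_KMSStates {Ω : WeakDual ℂ (CStarDirectLimit φ)}
    (h : ∀ j, WeakDual.pullback (of φ j) Ω ∈ KMSStates (α j) β) :
    Ω ∈ KMSStates (dynamics hα) β := by
  have hΩ : Continuous Ω := (WeakDual.toStrongDual Ω).continuous
  refine ⟨⟨fun x => ?_, ?_⟩, fun h0 => ⟨fun t x => ?_, fun x y => ?_⟩, fun h0 a b _ f hf => ?_⟩
  · refine induction_on_closed (p := fun x => 0 ≤ Ω (star x * x))
      (isClosed_le continuous_const (by fun_prop)) (fun j a => ?_) x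
    rw [← map_star, ← map_mul]
    exact (h j).1.nonneg a
  · rw [← map_one (of φ 0)]
    exact (h 0).1.map_one
  · refine induction_on_closed (p := fun x => Ω (dynamics hα t x) = Ω x)
      (isClosed_eq (hΩ.comp (action hα t).toCLM.continuous) hΩ) (fun j a => ?_) x
    rw [intertwines_of hα j t a]
    exact ((h j).2.1 h0).1 t a
  · refine denseRange_mk.induction_on₂ (p := fun x y => Ω (x * y) = Ω (y * x))
      (isClosed_eq (by fun_prop) (by fun_prop)) (fun x y => ?_) x y
    obtain ⟨N, a, b, h1, h2⟩ := exists_mk_eq_of₂ x y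
    rw [h1, h2, ← map_mul, ← map_mul]
    exact ((h N).2.1 h0).2 a b
  · refine (dynamics hα).kms_of_denseRange denseRange_mk (WeakDual.toStrongDual Ω) _
      (fun m hm x y => ?_) hf
    obtain ⟨N, a, b, h1, h2⟩ := exists_mk_eq_of₂ x y
    rw [h1, h2, (intertwines_of hα N).map_smear, (intertwines_of hα N).map_smear,
      (intertwines_of hα N).map_smear, ← map_mul (of φ N), ← map_mul (of φ N)]
    exact (h N).2.2 h0 _ _ ⟨_, (α N).isEntireExtension_smear hm b⟩ _
      ((α N).isEntireExtension_smear hm a)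

theorem exists_KMSStates (y : KMSProjLimit hα β) :
    ∃ Ω : KMSStates (dynamics hα) β, ∀ j a,
      (Ω : WeakDual ℂ (CStarDirectLimit φ)) (of φ j a) = (y.1 j : WeakDual ℂ (A j)) a := by
  obtain ⟨Ω, h1, -⟩ := exists_functional (ω := fun j => (y.1 j : WeakDual ℂ (A j)))
    (fun j a => (y.1 j).2.1.norm_apply_le a)
    fun j a => DFunLike.congr_fun (congrArg Subtype.val (y.2 j)) a
  refine ⟨⟨Ω, mem_KMSStates fun j => ?_⟩, h1⟩
  have h2 : WeakDual.pullback (of φ j) Ω = (y.1 j : WeakDual ℂ (A j)) := DFunLike.ext _ _ (h1 j)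
  rw [h2]
  exact (y.1 j).2

/-- A map into the states of the direct limit is weak* continuous as soon as its evaluations on the
images of the `A j` are continuous: states are contractive, so the other evaluations are uniform
limits of these. -/
theorem continuous_of_continuous_of {X : Type*} [TopologicalSpace X]
    {g : X → WeakDual ℂ (CStarDirectLimit φ)} (hg : ∀ x, IsCStarState (g x))
    (h : ∀ j a, Continuous fun x => g x (of φ j a)) : Continuous g := by
  refine WeakDual.continuous_of_continuous_eval fun c => ?_
  refine continuous_of_uniform_approx_of_continuous fun u hu => ?_
  obtain ⟨ε, hε, hu⟩ := Metric.mem_uniformity_dist.1 hu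
  obtain ⟨y, hy⟩ := denseRange_mk.exists_dist_lt c hε
  obtain ⟨N, a, -, h1, -⟩ := exists_mk_eq_of₂ y y
  refine ⟨fun x => g x (of φ N a), h N a, fun x => hu ?_⟩
  rw [← h1, dist_eq_norm, ← map_sub]
  refine ((hg x).norm_apply_le _).trans_lt ?_
  rwa [← dist_eq_norm]

/-- Restriction to the `A j`, as a homeomorphism from the KMS states of the direct limit onto the
projective limit of the KMS states of the `A j`. -/
noncomputable def kmsHomeomorph (hα : ∀ j, (α j).Intertwines (α (j + 1)) (φ j)) (β : ℝ) :
    KMSStates (dynamics hα) β ≃ₜ KMSProjLimit hα β where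
  toFun ω := ⟨fun j => KMSStates.restrict (intertwines_of hα j) β ω, fun j =>
    Subtype.ext (DFunLike.ext _ _ fun a =>
      congrArg (ω : WeakDual ℂ (CStarDirectLimit φ)) (of_succ j a))⟩
  invFun y := (exists_KMSStates y).choose
  left_inv ω := Subtype.ext (weakDual_ext fun j a => (exists_KMSStates _).choose_spec j a)
  right_inv y := Subtype.ext (funext fun j => Subtype.ext (DFunLike.ext _ _ fun a =>
    (exists_KMSStates y).choose_spec j a))
  continuous_toFun := by
    refine Continuous.subtype_mk (continuous_pi fun j => Continuous.subtype_mk ?_ _) _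
    exact WeakDual.continuous_of_continuous_eval fun a =>
      (WeakDual.eval_continuous (of φ j a)).comp continuous_subtype_val
  continuous_invFun := by
    refine Continuous.subtype_mk (continuous_of_continuous_of
      (fun y => (exists_KMSStates y).choose.2.1) fun j a => ?_) _
    refine Continuous.congr ?_ fun y => ((exists_KMSStates y).choose_spec j a).symm
    exact (WeakDual.eval_continuous a).comp (continuous_subtype_val.comp
      ((continuous_apply j).comp continuous_subtype_val))

end CStarDirectLimit

theorem mainTheorem6 {A : ℕ → Type u} [∀ j, CStarAlgebra (A j)]
    (φ : ∀ j, A j →⋆ₐ[ℂ] A (j + 1)) (hφ : ∀ j, Function.Injective (φ j))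
    (α : ∀ j, CStarDynamics (A j))
    (hα : ∀ j, (α j).Intertwines (α (j + 1)) (φ j)) :
    ∃ γ : CStarDynamics (CStarDirectLimit φ),
      (∀ j, (α j).Intertwines γ (CStarDirectLimit.of φ j)) ∧
      ∀ β : ℝ, 0 ≤ β →
        ∃ h : KMSStates γ β ≃ₜ KMSProjLimit hα β,
          (∀ (ω : KMSStates γ β) (j : ℕ) (a : A j),
            ((h ω).1 j : WeakDual ℂ (A j)) a =
              (ω : WeakDual ℂ (CStarDirectLimit φ)) (CStarDirectLimit.of φ j a)) ∧
          ∀ (μ ν : KMSStates γ β) (s t : ℝ) (hs : 0 ≤ s) (ht : 0 ≤ t) (hst : s + t = 1) (j : ℕ),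
            (h (KMSStates.convexComb μ ν hs ht hst)).1 j =
              KMSStates.convexComb ((h μ).1 j) ((h ν).1 j) hs ht hst :=
  ⟨CStarDirectLimit.dynamics hα, CStarDirectLimit.intertwines_of hα, fun β _ =>
    ⟨CStarDirectLimit.kmsHomeomorph hα β, fun _ _ _ => rfl, fun _ _ _ _ _ _ _ _ => rfl⟩⟩
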